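/- Let $M$ be a smooth manifold, $f\colon M\to\mathbb R$ a smooth function and $S=f^{-1}(0)$. Let $N$ be a submanifold of $M$ (possibly with boundary) that is not contained in $S$, with inclusion $\iota\colon N\hookrightarrow M$, and write $f$ also for $f\circ\iota$. Let $H^\bullet_f(M)$ be the cohomology of the complex $(\Omega^\bullet(M),d_f)$, where $$d_f\alpha=f\,d\alpha-k\,df\wedge\alpha\qquad(\alpha\in\Omega^k(M)),$$ and define $H^\bullet_f(N)$ likewise. Let $H^\bullet_f(M,N)$ be the relative cohomology, that is, the cohomology of the complex $$\Omega^k(M,N)=\Omega^k(M)\oplus\Omega^{k-1}(N),\qquad d_f(\alpha,\theta)=(d_f\alpha,\ \iota^*\alpha-d_f\theta),$$ with $\Omega^{-1}(N)=0$. Then there is a long exact sequence $$0\to H^0_f(M,N)\to H^0_f(M)\to\cdots\to H^{k-1}_f(N)\to H^k_f(M,N)\to H^k_f(M)\xrightarrow{\ \iota^*\ }H^k_f(N)\to\cdots$$ in which the maps are the well-defined linear maps $[\theta]\mapsto[(0,\theta)]$, $[(\alpha,\theta)]\mapsto[\alpha]$ and $\iota^*[\alpha]=[\iota^*\alpha]$.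 -/

import Mathlib

set_option linter.unusedSectionVars false

open Set
open scoped Manifold ContDiff Topology

namespace FunctionCohomology

section LinearAlgebra

variable {E F : Type*} [NormedAddCommGroup E] [NormedSpace ℝ E]
  [NormedAddCommGroup F] [NormedSpace ℝ F]

/-- The exterior product `φ ∧ α` of a linear form `φ` and an alternating `k`-form `α`:
`(φ ∧ α)(v₀, …, v_k) = ∑ i, (-1)^i φ(v_i) α(v₀, …, v̂_i, …, v_k)`. -/
noncomputable def wedgeOne {k : ℕ} (φ : E →L[ℝ] ℝ) (α : E [⋀^Fin k]→L[ℝ] ℝ) :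
    E [⋀^Fin (k + 1)]→L[ℝ] ℝ :=
  ContinuousAlternatingMap.alternatizeUncurryFin (φ.smulRight α)

theorem wedgeOne_apply {k : ℕ} (φ : E →L[ℝ] ℝ) (α : E [⋀^Fin k]→L[ℝ] ℝ) (v : Fin (k + 1) → E) :
    wedgeOne φ α v = ∑ i : Fin (k + 1), (-1) ^ (i : ℕ) * (φ (v i) * α (i.removeNth v)) := by
  simp [wedgeOne, ContinuousAlternatingMap.alternatizeUncurryFin_apply]

theorem wedgeOne_comp {k : ℕ} (φ : F →L[ℝ] ℝ) (α : F [⋀^Fin k]→L[ℝ] ℝ) (L : E →L[ℝ] F) :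
    (wedgeOne φ α).compContinuousLinearMap L =
      wedgeOne (φ.comp L) (α.compContinuousLinearMap L) := by
  ext v
  simp only [ContinuousAlternatingMap.compContinuousLinearMap_apply, wedgeOne_apply]
  rfl

theorem wedgeOne_add {k : ℕ} (φ : E →L[ℝ] ℝ) (α β : E [⋀^Fin k]→L[ℝ] ℝ) :
    wedgeOne φ (α + β) = wedgeOne φ α + wedgeOne φ β := by
  ext v
  simp only [wedgeOne_apply, ContinuousAlternatingMap.add_apply, mul_add, Finset.sum_add_distrib]

theorem wedgeOne_smul {k : ℕ} (φ : E →L[ℝ] ℝ) (c : ℝ) (α : E [⋀^Fin k]→L[ℝ] ℝ) :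
    wedgeOne φ (c • α) = c • wedgeOne φ α := by
  ext v
  simp only [wedgeOne_apply, ContinuousAlternatingMap.smul_apply, smul_eq_mul, Finset.mul_sum]
  exact Finset.sum_congr rfl fun i _ => by ring

theorem contDiffOn_wedgeOne {k : ℕ} {s : Set E} {φ : E → E →L[ℝ] ℝ} {α : E → E [⋀^Fin k]→L[ℝ] ℝ}
    (hφ : ContDiffOn ℝ ∞ φ s) (hα : ContDiffOn ℝ ∞ α s) :
    ContDiffOn ℝ ∞ (fun x => wedgeOne (φ x) (α x)) s := by
  let A : (E →L[ℝ] E [⋀^Fin k]→L[ℝ] ℝ) →L[ℝ] E [⋀^Fin (k + 1)]→L[ℝ] ℝ :=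
    ContinuousAlternatingMap.alternatizeUncurryFinCLM ℝ E ℝ
  exact A.contDiff.comp_contDiffOn (hφ.smulRight hα)

/-- Alternatization as a continuous linear map. -/
noncomputable def altCLM (k : ℕ) :
    ContinuousMultilinearMap ℝ (fun _ : Fin k => E) ℝ →L[ℝ] E [⋀^Fin k]→L[ℝ] ℝ :=
  LinearMap.mkContinuous
    { toFun := fun f => ContinuousMultilinearMap.alternatization f
      map_add' := fun f g => map_add _ f g
      map_smul' := fun c f => by
        ext v
        simp only [ContinuousMultilinearMap.alternatization_apply_apply,
          _root_.smul_apply, ContinuousAlternatingMap.smul_apply,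
          Finset.smul_sum, RingHom.id_apply]
        exact Finset.sum_congr rfl fun σ _ => smul_comm _ _ _ }
    (Fintype.card (Equiv.Perm (Fin k)))
    (fun f => by
      refine ContinuousAlternatingMap.opNorm_le_bound _ (by positivity) fun v => ?_
      simp only [LinearMap.coe_mk, AddHom.coe_mk,
        ContinuousMultilinearMap.alternatization_apply_apply]
      refine (norm_sum_le _ _).trans ?_
      have h : ∀ σ ∈ (Finset.univ : Finset (Equiv.Perm (Fin k))),
          ‖Equiv.Perm.sign σ • f (v ∘ σ)‖ ≤ ‖f‖ * ∏ i, ‖v i‖ := by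
        intro σ _
        have h1 : ‖Equiv.Perm.sign σ • f (v ∘ σ)‖ = ‖f (v ∘ σ)‖ := by
          rcases Int.units_eq_one_or (Equiv.Perm.sign σ) with h | h <;> simp [h]
        rw [h1]
        refine (f.le_opNorm _).trans (le_of_eq ?_)
        congr 1
        exact Equiv.prod_comp σ (fun i => ‖v i‖)
      refine (Finset.sum_le_card_nsmul _ _ _ h).trans (le_of_eq ?_)
      simp [mul_assoc])

theorem altCLM_toMultilinear {k : ℕ} (η : E [⋀^Fin k]→L[ℝ] ℝ) :
    altCLM k η.toContinuousMultilinearMap = (k.factorial : ℝ) • η := by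
  ext v
  have h : ∀ σ : Equiv.Perm (Fin k), Equiv.Perm.sign σ • η (v ∘ σ) = η v := by
    intro σ
    have h1 : η (v ∘ σ) = Equiv.Perm.sign σ • η v := η.toAlternatingMap.map_perm v σ
    rw [h1, smul_smul, Int.units_mul_self, one_smul]
  change ContinuousMultilinearMap.alternatization η.toContinuousMultilinearMap v = _
  rw [ContinuousMultilinearMap.alternatization_apply_apply]
  change ∑ σ : Equiv.Perm (Fin k), Equiv.Perm.sign σ • η (v ∘ σ) = _
  simp [h, Fintype.card_perm]

theorem contDiffWithinAt_pullback {G : Type*} [NormedAddCommGroup G] [NormedSpace ℝ G] {k : ℕ}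
    {n : WithTop ℕ∞} {s : Set G} {x : G} {η : G → F [⋀^Fin k]→L[ℝ] ℝ} {L : G → E →L[ℝ] F}
    (hη : ContDiffWithinAt ℝ n η s x) (hL : ContDiffWithinAt ℝ n L s x) :
    ContDiffWithinAt ℝ n (fun x => (η x).compContinuousLinearMap (L x)) s x := by
  have key : (fun x => (η x).compContinuousLinearMap (L x)) = fun x =>
      (k.factorial : ℝ)⁻¹ • altCLM k
        ((ContinuousMultilinearMap.compContinuousLinearMapContinuousMultilinear ℝ
          (fun _ : Fin k => E) (fun _ => F) ℝ (fun _ => L x))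
          (ContinuousAlternatingMap.toContinuousMultilinearMapCLM ℝ (η x))) := by
    funext x
    have := altCLM_toMultilinear ((η x).compContinuousLinearMap (L x))
    have hk : (k.factorial : ℝ) ≠ 0 := by positivity
    rw [eq_inv_smul_iff₀ hk, ← this]
    rfl
  rw [key]
  refine ((altCLM (E := E) k).contDiff.comp_contDiffWithinAt (ContDiffWithinAt.clm_apply ?_ ?_)).const_smul _
  · exact (ContinuousMultilinearMap.contDiff _).comp_contDiffWithinAt
      (contDiffWithinAt_pi.2 fun _ => hL)
  · exact (ContinuousAlternatingMap.toContinuousMultilinearMapCLM ℝ).contDiff.comp_contDiffWithinAt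
      hη

theorem contDiffWithinAt_extDerivWithin {k : ℕ} {s : Set E} {x : E} {η : E → E [⋀^Fin k]→L[ℝ] ℝ}
    (hη : ContDiffWithinAt ℝ ∞ η s x) (hs : UniqueDiffOn ℝ s) (hx : x ∈ s) :
    ContDiffWithinAt ℝ ∞ (extDerivWithin η s) s x := by
  have h : ContDiffWithinAt ℝ ∞ (fderivWithin ℝ η s) s x := hη.fderivWithin_right hs (by simp) hx
  let A : (E →L[ℝ] E [⋀^Fin k]→L[ℝ] ℝ) →L[ℝ] E [⋀^Fin (k + 1)]→L[ℝ] ℝ :=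
    ContinuousAlternatingMap.alternatizeUncurryFinCLM ℝ E ℝ
  exact A.contDiff.comp_contDiffWithinAt h

end LinearAlgebra

section Forms

variable {E : Type*} [NormedAddCommGroup E] [NormedSpace ℝ E]
  {H : Type*} [TopologicalSpace H] {I : ModelWithCorners ℝ E H}
  {M : Type*} [TopologicalSpace M] [ChartedSpace H M]
  {E' : Type*} [NormedAddCommGroup E'] [NormedSpace ℝ E']
  {H' : Type*} [TopologicalSpace H'] {J : ModelWithCorners ℝ E' H'}
  {N : Type*} [TopologicalSpace N] [ChartedSpace H' N]

variable (I M) in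
/-- Families of alternating `k`-linear forms on the tangent spaces of `M`
(differential `k`-forms without any regularity). -/
def RoughForm (k : ℕ) := ∀ x : M, TangentSpace I x [⋀^Fin k]→L[ℝ] ℝ

noncomputable instance (k : ℕ) : AddCommGroup (RoughForm I M k) :=
  inferInstanceAs (AddCommGroup (∀ x : M, TangentSpace I x [⋀^Fin k]→L[ℝ] ℝ))

noncomputable instance (k : ℕ) : Module ℝ (RoughForm I M k) :=
  inferInstanceAs (Module ℝ (∀ x : M, TangentSpace I x [⋀^Fin k]→L[ℝ] ℝ))

/-- The expression of a form in the chart around `x₀`: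
its pullback by the inverse of the chart. -/
noncomputable def inChart {k : ℕ} (α : RoughForm I M k) (x₀ : M) (y : E) : E [⋀^Fin k]→L[ℝ] ℝ :=
  (α ((extChartAt I x₀).symm y)).compContinuousLinearMap
    (mfderivWithin 𝓘(ℝ, E) I (extChartAt I x₀).symm (range I) y)

variable (I M) in
/-- The space `Ω^k(M)` of smooth differential `k`-forms: all expressions in charts are smooth
(up to the boundary, if there is one). -/
def Form (k : ℕ) : Submodule ℝ (RoughForm I M k) where
  carrier := {α | ∀ x₀ : M, ContDiffOn ℝ ∞ (inChart α x₀) (extChartAt I x₀).target}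
  add_mem' := fun ha hb x₀ => (ha x₀).add (hb x₀)
  zero_mem' := fun _ => contDiffOn_const (c := (0 : E [⋀^Fin k]→L[ℝ] ℝ))
  smul_mem' := fun c _ ha x₀ => (ha x₀).const_smul c

/-- The exterior derivative `dα`: computed at `x` in the chart around `x`. -/
noncomputable def roughD {k : ℕ} (α : RoughForm I M k) : RoughForm I M (k + 1) := fun x =>
  (extDerivWithin (inChart α x) (range I) (extChartAt I x x)).compContinuousLinearMap
    (mfderiv I 𝓘(ℝ, E) (extChartAt I x) x)

/-- The form `dg ∧ α`. -/
noncomputable def roughWedge {k : ℕ} (g : M → ℝ) (α : RoughForm I M k) :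
    RoughForm I M (k + 1) := fun x =>
  wedgeOne (E := E) (mfderiv I 𝓘(ℝ, ℝ) g x) (α x)

/-- The pullback `φ^* α` of a form by a map `φ : N → M`. -/
noncomputable def roughPullback {k : ℕ} (φ : N → M) (α : RoughForm I M k) : RoughForm J N k :=
  fun x => (α (φ x)).compContinuousLinearMap (mfderiv J I φ x)

theorem differentiableWithinAt_inChart {k : ℕ} {α : RoughForm I M k} (hα : α ∈ Form I M k)
    {x₀ : M} {y : E} (hy : y ∈ (extChartAt I x₀).target) :
    DifferentiableWithinAt ℝ (inChart α x₀) (range I) y :=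
  (((hα x₀) y hy).differentiableWithinAt (by simp)).mono_of_mem_nhdsWithin
    (extChartAt_target_mem_nhdsWithin_of_mem hy)

section Pullback

variable [IsManifold I ∞ M] [IsManifold J ∞ N]

theorem contDiffWithinAt_chartExpr {φ : N → M} (hφ : ContMDiff J I ∞ φ) {x₀ : N} {m₀ : M}
    {y : E'} (hy : y ∈ (extChartAt J x₀).target)
    (hm : φ ((extChartAt J x₀).symm y) ∈ (extChartAt I m₀).source) :
    ContDiffWithinAt ℝ ∞ (extChartAt I m₀ ∘ φ ∘ (extChartAt J x₀).symm) (range J) y := by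
  rw [← contMDiffWithinAt_iff_contDiffWithinAt]
  have h1 : ContMDiffAt I 𝓘(ℝ, E) ∞ (extChartAt I m₀) (φ ((extChartAt J x₀).symm y)) :=
    contMDiffAt_extChartAt' (by rwa [← extChartAt_source (I := I)])
  have h2 : ContMDiffWithinAt 𝓘(ℝ, E') I ∞ (φ ∘ (extChartAt J x₀).symm) (range J) y :=
    (hφ _).comp_contMDiffWithinAt y (contMDiffWithinAt_extChartAt_symm_range x₀ hy)
  exact h1.comp_contMDiffWithinAt y h2

/-- In charts, the pullback of forms is the pullback by the chart expression of the map. -/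
theorem inChart_roughPullback {k : ℕ} {φ : N → M} (hφ : ContMDiff J I ∞ φ) (α : RoughForm I M k)
    {x₀ : N} {m₀ : M} {y : E'} (hy : y ∈ (extChartAt J x₀).target)
    (hm : φ ((extChartAt J x₀).symm y) ∈ (extChartAt I m₀).source) :
    inChart (roughPullback (J := J) φ α) x₀ y =
      (inChart α m₀ ((extChartAt I m₀ ∘ φ ∘ (extChartAt J x₀).symm) y)).compContinuousLinearMap
        (fderivWithin ℝ (extChartAt I m₀ ∘ φ ∘ (extChartAt J x₀).symm) (range J) y) := by
  have : IsManifold I 1 M := IsManifold.of_le (n := ∞) (by simp)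
  have : IsManifold J 1 N := IsManifold.of_le (n := ∞) (by simp)
  set g := extChartAt I m₀ ∘ φ ∘ (extChartAt J x₀).symm with hg
  have U : UniqueMDiffWithinAt 𝓘(ℝ, E') (range J) y :=
    J.uniqueMDiffOn _ (extChartAt_target_subset_range x₀ hy)
  have hgy : g y ∈ (extChartAt I m₀).target := (extChartAt I m₀).map_source hm
  have hback : (extChartAt I m₀).symm (g y) = φ ((extChartAt J x₀).symm y) :=
    (extChartAt I m₀).left_inv hm
  have hdg : MDifferentiableWithinAt 𝓘(ℝ, E') 𝓘(ℝ, E) g (range J) y :=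
    ((contDiffWithinAt_chartExpr hφ hy hm).differentiableWithinAt
      (by simp)).mdifferentiableWithinAt
  have hds := mdifferentiableWithinAt_extChartAt_symm (I := J) hy
  have e1 : mfderivWithin 𝓘(ℝ, E') I ((extChartAt I m₀).symm ∘ g) (range J) y =
      (mfderivWithin 𝓘(ℝ, E) I (extChartAt I m₀).symm (range I) (g y)).comp
        (mfderivWithin 𝓘(ℝ, E') 𝓘(ℝ, E) g (range J) y) := by
    refine mfderivWithin_comp _ (mdifferentiableWithinAt_extChartAt_symm hgy) hdg ?_ U
    intro z _
    exact mem_range_self (f := I) _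
  have e2 : mfderivWithin 𝓘(ℝ, E') I (φ ∘ (extChartAt J x₀).symm) (range J) y =
      (mfderiv J I φ ((extChartAt J x₀).symm y)).comp
        (mfderivWithin 𝓘(ℝ, E') J (extChartAt J x₀).symm (range J) y) :=
    mfderiv_comp_mfderivWithin _ ((hφ _).mdifferentiableAt (by simp)) hds U
  have e3 : mfderivWithin 𝓘(ℝ, E') I ((extChartAt I m₀).symm ∘ g) (range J) y =
      mfderivWithin 𝓘(ℝ, E') I (φ ∘ (extChartAt J x₀).symm) (range J) y := by
    refine Filter.EventuallyEq.mfderivWithin_eq ?_ hback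
    have hc : ContinuousWithinAt (φ ∘ (extChartAt J x₀).symm) (range J) y :=
      (hφ.continuous.continuousAt).comp_continuousWithinAt hds.continuousWithinAt
    filter_upwards [hc.preimage_mem_nhdsWithin
      (extChartAt_source_mem_nhds' (I := I) hm)] with z hz
    exact (extChartAt I m₀).left_inv hz
  have e4 : mfderivWithin 𝓘(ℝ, E') 𝓘(ℝ, E) g (range J) y = fderivWithin ℝ g (range J) y :=
    mfderivWithin_eq_fderivWithin
  let α' : M → E [⋀^Fin k]→L[ℝ] ℝ := α
  have hα' : α' ((extChartAt I m₀).symm (g y)) = α' (φ ((extChartAt J x₀).symm y)) := by rw [hback]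
  ext v
  have hL : ∀ w : E', (mfderiv J I φ ((extChartAt J x₀).symm y)
      (mfderivWithin 𝓘(ℝ, E') J (extChartAt J x₀).symm (range J) y w) : E) =
      mfderivWithin 𝓘(ℝ, E) I (extChartAt I m₀).symm (range I) (g y)
        (fderivWithin ℝ g (range J) y w) := by
    intro w
    have h := congrArg (fun L : E' →L[ℝ] E => L w) (e2.symm.trans (e3.symm.trans e1))
    rw [e4] at h
    exact h
  change α' (φ ((extChartAt J x₀).symm y)) (fun i => (mfderiv J I φ ((extChartAt J x₀).symm y)
      (mfderivWithin 𝓘(ℝ, E') J (extChartAt J x₀).symm (range J) y (v i)) : E)) =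
    α' ((extChartAt I m₀).symm (g y)) (fun i =>
      (mfderivWithin 𝓘(ℝ, E) I (extChartAt I m₀).symm (range I) (g y)
        (fderivWithin ℝ g (range J) y (v i)) : E))
  rw [hα']
  congr 1
  funext i
  exact hL (v i)

theorem eventually_mem_source {φ : N → M} (hφ : ContMDiff J I ∞ φ) {x₀ : N} {m₀ : M}
    {y : E'} (hy : y ∈ (extChartAt J x₀).target)
    (hm : φ ((extChartAt J x₀).symm y) ∈ (extChartAt I m₀).source) :
    ∀ᶠ z in 𝓝[range J] y, z ∈ (extChartAt J x₀).target ∧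
      φ ((extChartAt J x₀).symm z) ∈ (extChartAt I m₀).source := by
  have : IsManifold J 1 N := IsManifold.of_le (n := ∞) (by simp)
  have hds := mdifferentiableWithinAt_extChartAt_symm (I := J) hy
  have hc : ContinuousWithinAt (φ ∘ (extChartAt J x₀).symm) (range J) y :=
    (hφ.continuous.continuousAt).comp_continuousWithinAt hds.continuousWithinAt
  filter_upwards [hc.preimage_mem_nhdsWithin (extChartAt_source_mem_nhds' (I := I) hm),
    extChartAt_target_mem_nhdsWithin_of_mem hy] with z hz hz'
  exact ⟨hz', hz⟩

theorem roughPullback_mem {k : ℕ} {φ : N → M} (hφ : ContMDiff J I ∞ φ) {α : RoughForm I M k}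
    (hα : α ∈ Form I M k) : roughPullback (J := J) φ α ∈ Form J N k := by
  intro x₀ y hy
  set m₀ := φ ((extChartAt J x₀).symm y) with hm₀
  have hm : φ ((extChartAt J x₀).symm y) ∈ (extChartAt I m₀).source := mem_extChartAt_source m₀
  set g := extChartAt I m₀ ∘ φ ∘ (extChartAt J x₀).symm with hg
  have hyr := extChartAt_target_subset_range x₀ hy
  have hgs : ContDiffWithinAt ℝ ∞ g (range J) y := contDiffWithinAt_chartExpr hφ hy hm
  have hgy : g y ∈ (extChartAt I m₀).target := (extChartAt I m₀).map_source hm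
  have h1 : ContDiffWithinAt ℝ ∞ (fun z => inChart α m₀ (g z)) (range J) y := by
    refine (((hα m₀) _ hgy).mono_of_mem_nhdsWithin
      (extChartAt_target_mem_nhdsWithin_of_mem hgy)).comp (t := range I) y hgs ?_
    intro z _
    exact mem_range_self (f := I) _
  have h2 : ContDiffWithinAt ℝ ∞ (fun z => fderivWithin ℝ g (range J) z) (range J) y :=
    hgs.fderivWithin_right J.uniqueDiffOn (by simp) hyr
  refine ((contDiffWithinAt_pullback h1 h2).congr_of_eventuallyEq ?_ ?_).mono
    (extChartAt_target_subset_range x₀)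
  · filter_upwards [eventually_mem_source hφ hy hm] with z hz
    exact inChart_roughPullback hφ α hz.1 hz.2
  · exact inChart_roughPullback hφ α hy hm

end Pullback

section Derivative

variable [IsManifold I ∞ M]

theorem roughPullback_id {k : ℕ} (α : RoughForm I M k) :
    roughPullback (J := I) (id : M → M) α = α := by
  funext x
  ext v
  simp only [roughPullback, mfderiv_id]
  rfl

/-- In any chart, the exterior derivative of forms is the one of the model space. -/
theorem inChart_roughD {k : ℕ} {α : RoughForm I M k} (hα : α ∈ Form I M k) {x₀ : M} {y : E}
    (hy : y ∈ (extChartAt I x₀).target) :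
    inChart (roughD α) x₀ y = extDerivWithin (inChart α x₀) (range I) y := by
  have : IsManifold I 1 M := IsManifold.of_le (n := ∞) (by simp)
  set p := (extChartAt I x₀).symm y with hp
  have hm : id ((extChartAt I x₀).symm y) ∈ (extChartAt I p).source := mem_extChartAt_source p
  have hid : ContMDiff I I ∞ (id : M → M) := contMDiff_id
  set g := extChartAt I p ∘ id ∘ (extChartAt I x₀).symm with hg
  have hyr := extChartAt_target_subset_range x₀ hy
  have hgs : ContDiffWithinAt ℝ ∞ g (range I) y := contDiffWithinAt_chartExpr hid hy hm
  have hgy : g y ∈ (extChartAt I p).target := (extChartAt I p).map_source hm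
  have e1 : extDerivWithin (inChart α x₀) (range I) y =
      extDerivWithin (fun z => (inChart α p (g z)).compContinuousLinearMap
        (fderivWithin ℝ g (range I) z)) (range I) y := by
    refine Filter.EventuallyEq.extDerivWithin_eq_of_mem ?_ hyr
    filter_upwards [eventually_mem_source hid hy hm] with z hz
    conv_lhs => rw [← roughPullback_id α]
    exact inChart_roughPullback hid α hz.1 hz.2
  rw [e1, extDerivWithin_pullback (r := ∞) (differentiableWithinAt_inChart hα hgy) hgs
    (by simpa using WithTop.coe_le_coe.2 (le_top : (2 : ℕ∞) ≤ ⊤)) I.uniqueDiffOn (I.range_subset_closure_interior hyr) hyr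
    (fun z _ => mem_range_self (f := I) _)]
  have e2 : fderivWithin ℝ g (range I) y =
      (mfderiv I 𝓘(ℝ, E) (extChartAt I p) p).comp
        (mfderivWithin 𝓘(ℝ, E) I (extChartAt I x₀).symm (range I) y) := by
    rw [← mfderivWithin_eq_fderivWithin]
    exact mfderiv_comp_mfderivWithin _ (mdifferentiableAt_extChartAt (mem_chart_source H p))
      (mdifferentiableWithinAt_extChartAt_symm hy)
      (I.uniqueMDiffOn _ hyr)
  rw [e2]
  rfl

theorem roughD_mem {k : ℕ} {α : RoughForm I M k} (hα : α ∈ Form I M k) :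
    roughD α ∈ Form I M (k + 1) := by
  intro x₀ y hy
  have hyr := extChartAt_target_subset_range x₀ hy
  have h1 : ContDiffWithinAt ℝ ∞ (inChart α x₀) (range I) y :=
    ((hα x₀) y hy).mono_of_mem_nhdsWithin (extChartAt_target_mem_nhdsWithin_of_mem hy)
  have h3 : ContDiffWithinAt ℝ ∞ (extDerivWithin (inChart α x₀) (range I)) (range I) y :=
    contDiffWithinAt_extDerivWithin h1 I.uniqueDiffOn hyr
  refine (h3.mono (extChartAt_target_subset_range x₀)).congr ?_ ?_
  · intro z hz
    exact inChart_roughD hα hz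
  · exact inChart_roughD hα hy

theorem contDiffWithinAt_inChart_fun {g : M → ℝ} (hg : ContMDiff I 𝓘(ℝ, ℝ) ∞ g) {x₀ : M} {y : E}
    (hy : y ∈ (extChartAt I x₀).target) :
    ContDiffWithinAt ℝ ∞ (g ∘ (extChartAt I x₀).symm) (range I) y := by
  rw [← contMDiffWithinAt_iff_contDiffWithinAt]
  exact (hg _).comp_contMDiffWithinAt y (contMDiffWithinAt_extChartAt_symm_range x₀ hy)

theorem inChart_roughWedge {k : ℕ} {g : M → ℝ} (hg : ContMDiff I 𝓘(ℝ, ℝ) ∞ g)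
    (α : RoughForm I M k) {x₀ : M} {y : E} (hy : y ∈ (extChartAt I x₀).target) :
    inChart (roughWedge g α) x₀ y =
      wedgeOne (fderivWithin ℝ (g ∘ (extChartAt I x₀).symm) (range I) y) (inChart α x₀ y) := by
  have : IsManifold I 1 M := IsManifold.of_le (n := ∞) (by simp)
  have e : fderivWithin ℝ (g ∘ (extChartAt I x₀).symm) (range I) y =
      (mfderiv I 𝓘(ℝ, ℝ) g ((extChartAt I x₀).symm y)).comp
        (mfderivWithin 𝓘(ℝ, E) I (extChartAt I x₀).symm (range I) y) := by
    rw [← mfderivWithin_eq_fderivWithin]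
    exact mfderiv_comp_mfderivWithin _ ((hg _).mdifferentiableAt (by simp))
      (mdifferentiableWithinAt_extChartAt_symm hy)
      (I.uniqueMDiffOn _ (extChartAt_target_subset_range x₀ hy))
  rw [e]
  exact wedgeOne_comp (E := E) (F := E) (mfderiv I 𝓘(ℝ, ℝ) g ((extChartAt I x₀).symm y))
    (α ((extChartAt I x₀).symm y))
    (mfderivWithin 𝓘(ℝ, E) I (extChartAt I x₀).symm (range I) y)

theorem roughWedge_mem {k : ℕ} {g : M → ℝ} (hg : ContMDiff I 𝓘(ℝ, ℝ) ∞ g) {α : RoughForm I M k}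
    (hα : α ∈ Form I M k) : roughWedge g α ∈ Form I M (k + 1) := by
  intro x₀
  have h : ContDiffOn ℝ ∞ (fderivWithin ℝ (g ∘ (extChartAt I x₀).symm) (range I))
      (extChartAt I x₀).target := by
    intro y hy
    exact ((contDiffWithinAt_inChart_fun hg hy).fderivWithin_right I.uniqueDiffOn (by simp)
      (extChartAt_target_subset_range x₀ hy)).mono (extChartAt_target_subset_range x₀)
  exact (contDiffOn_wedgeOne h (hα x₀)).congr fun y hy => inChart_roughWedge hg α hy

theorem fun_smul_mem {k : ℕ} {g : M → ℝ} (hg : ContMDiff I 𝓘(ℝ, ℝ) ∞ g) {α : RoughForm I M k}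
    (hα : α ∈ Form I M k) : (fun x => g x • α x : RoughForm I M k) ∈ Form I M k := by
  intro x₀
  have h : ContDiffOn ℝ ∞ (g ∘ (extChartAt I x₀).symm) (extChartAt I x₀).target := fun y hy =>
    (contDiffWithinAt_inChart_fun hg hy).mono (extChartAt_target_subset_range x₀)
  exact h.smul (hα x₀)

/-- The exterior derivative `d : Ω^k(M) → Ω^{k+1}(M)`. -/
noncomputable def extD (k : ℕ) : Form I M k →ₗ[ℝ] Form I M (k + 1) where
  toFun α := ⟨roughD α.1, roughD_mem α.2⟩
  map_add' := fun α β => by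
    apply Subtype.ext
    funext x
    have hx := mem_extChartAt_target (I := I) x
    have h := extDerivWithin_add (I.uniqueDiffOn _ (extChartAt_target_subset_range x hx))
      (differentiableWithinAt_inChart α.2 hx) (differentiableWithinAt_inChart β.2 hx)
    ext v
    exact congrArg (fun A : E [⋀^Fin (k + 1)]→L[ℝ] ℝ =>
      A.compContinuousLinearMap (mfderiv I 𝓘(ℝ, E) (extChartAt I x) x) v) h
  map_smul' := fun c α => by
    apply Subtype.ext
    funext x
    have hx := mem_extChartAt_target (I := I) x
    have h := extDerivWithin_smul c (inChart α.1 x)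
      (I.uniqueDiffOn _ (extChartAt_target_subset_range x hx))
    ext v
    exact congrArg (fun A : E [⋀^Fin (k + 1)]→L[ℝ] ℝ =>
      A.compContinuousLinearMap (mfderiv I 𝓘(ℝ, E) (extChartAt I x) x) v) h

/-- Multiplication `α ↦ g α` of forms by a smooth function. -/
noncomputable def mulFun (g : C^∞⟮I, M; 𝓘(ℝ, ℝ), ℝ⟯) (k : ℕ) : Form I M k →ₗ[ℝ] Form I M k where
  toFun α := ⟨fun x => g x • α.1 x, fun_smul_mem g.contMDiff α.2⟩
  map_add' := fun α β => Subtype.ext (funext fun x => smul_add (g x) (α.1 x) (β.1 x))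
  map_smul' := fun c α => Subtype.ext (funext fun x => smul_comm (g x) c (α.1 x))

/-- The map `α ↦ dg ∧ α`, `Ω^k(M) → Ω^{k+1}(M)`. -/
noncomputable def dWedge (g : C^∞⟮I, M; 𝓘(ℝ, ℝ), ℝ⟯) (k : ℕ) :
    Form I M k →ₗ[ℝ] Form I M (k + 1) where
  toFun α := ⟨roughWedge g α.1, roughWedge_mem g.contMDiff α.2⟩
  map_add' := fun α β => Subtype.ext (funext fun x =>
    wedgeOne_add (E := E) (mfderiv I 𝓘(ℝ, ℝ) g x) (α.1 x) (β.1 x))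
  map_smul' := fun c α => Subtype.ext (funext fun x =>
    wedgeOne_smul (E := E) (mfderiv I 𝓘(ℝ, ℝ) g x) c (α.1 x))

/-- The operator `d_f α = f dα - k df ∧ α` on `k`-forms. -/
noncomputable def twistedD (f : C^∞⟮I, M; 𝓘(ℝ, ℝ), ℝ⟯) (k : ℕ) :
    Form I M k →ₗ[ℝ] Form I M (k + 1) :=
  mulFun f (k + 1) ∘ₗ extD k - (k : ℝ) • dWedge f k

/-- The pullback `φ^* : Ω^k(M) → Ω^k(N)` by a smooth map `φ : N → M`. -/
noncomputable def pullback [IsManifold J ∞ N] (φ : C^∞⟮J, N; I, M⟯) (k : ℕ) :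
    Form I M k →ₗ[ℝ] Form J N k where
  toFun α := ⟨roughPullback φ α.1, roughPullback_mem φ.contMDiff α.2⟩
  map_add' := fun _ _ => rfl
  map_smul' := fun _ _ => rfl

end Derivative

end Forms

section Cohomology

universe u

variable {A : ℕ → Type u} [∀ k, AddCommGroup (A k)] [∀ k, Module ℝ (A k)]

/-- The coboundaries `B^k` of `A 0 → A 1 → A 2 → ⋯`; `B^0 = 0`. -/
def coboundaries (d : ∀ k, A k →ₗ[ℝ] A (k + 1)) : ∀ k, Submodule ℝ (A k)
  | 0 => ⊥
  | k + 1 => LinearMap.range (d k)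

/-- The cohomology `Z^k / B^k` of a complex `A 0 → A 1 → A 2 → ⋯`, where `Z^k = ker d^k`
(`submoduleOf` regards `B^k` as a subspace of `Z^k`). -/
abbrev Cohomology (d : ∀ k, A k →ₗ[ℝ] A (k + 1)) (k : ℕ) :=
  LinearMap.ker (d k) ⧸ (coboundaries d k).submoduleOf (LinearMap.ker (d k))

/-- The class `[a]` of a cocycle `a`. -/
def cohomologyClass (d : ∀ k, A k →ₗ[ℝ] A (k + 1)) {k : ℕ} (a : A k) (ha : d k a = 0) :
    Cohomology d k :=
  Submodule.Quotient.mk ⟨a, LinearMap.mem_ker.2 ha⟩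

end Cohomology

section Relative

universe v w

variable {E : Type*} [NormedAddCommGroup E] [NormedSpace ℝ E]
  {H : Type*} [TopologicalSpace H] {I : ModelWithCorners ℝ E H}
  {M : Type*} [TopologicalSpace M] [ChartedSpace H M] [IsManifold I ∞ M]
  {E' : Type v} [NormedAddCommGroup E'] [NormedSpace ℝ E']
  {H' : Type*} [TopologicalSpace H'] {J : ModelWithCorners ℝ E' H'}
  {N : Type w} [TopologicalSpace N] [ChartedSpace H' N] [IsManifold J ∞ N]

variable (J N) in
/-- The space `Ω^{k-1}(N)`, which is `0` for `k = 0`. -/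
def PrevForm : ℕ → Type (max v w)
  | 0 => PUnit
  | k + 1 => Form J N k

noncomputable instance : ∀ k, AddCommGroup (PrevForm J N k)
  | 0 => inferInstanceAs (AddCommGroup PUnit)
  | k + 1 => inferInstanceAs (AddCommGroup (Form J N k))

noncomputable instance : ∀ k, Module ℝ (PrevForm J N k)
  | 0 => (inferInstance : Module ℝ PUnit.{max v w + 1})
  | k + 1 => (inferInstance : Module ℝ (Form J N k))

/-- The operator `d_g : Ω^{k-1}(N) → Ω^k(N)`. -/
noncomputable def prevTwistedD (g : C^∞⟮J, N; 𝓘(ℝ, ℝ), ℝ⟯) :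
    ∀ k : ℕ, PrevForm J N k →ₗ[ℝ] Form J N k
  | 0 => 0
  | k + 1 => twistedD g k

variable (I M J N) in
/-- Relative forms for a map `N → M`: `Ω^k(M) ⊕ Ω^{k-1}(N)`. -/
abbrev RelForm (k : ℕ) := Form I M k × PrevForm J N k

/-- The differential `(α, θ) ↦ (d_f α, φ^* α - d_{f ∘ φ} θ)` of relative forms. -/
noncomputable def relD (f : C^∞⟮I, M; 𝓘(ℝ, ℝ), ℝ⟯) (φ : C^∞⟮J, N; I, M⟯) (k : ℕ) :
    RelForm I M J N k →ₗ[ℝ] RelForm I M J N (k + 1) :=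
  LinearMap.prod (twistedD f k ∘ₗ LinearMap.fst ℝ _ _)
    (pullback φ k ∘ₗ LinearMap.fst ℝ _ _ -
      prevTwistedD (f.comp φ) k ∘ₗ LinearMap.snd ℝ (Form I M k) (PrevForm J N k) :
        RelForm I M J N k →ₗ[ℝ] Form J N k)

/-- The cohomology `H^k_f(M)` of `(Ω^•(M), d_f)`. -/
abbrev HFun (f : C^∞⟮I, M; 𝓘(ℝ, ℝ), ℝ⟯) (k : ℕ) := Cohomology (twistedD f) k

/-- The relative cohomology `H^k_f(M, N)` of a map `ι : N → M`. -/
abbrev HRel (f : C^∞⟮I, M; 𝓘(ℝ, ℝ), ℝ⟯) (ι : C^∞⟮J, N; I, M⟯) (k : ℕ) :=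
  Cohomology (relD f ι) k

end Relative

end FunctionCohomology

open FunctionCohomology

/-! The relative complex is the mapping cone, up to shift and sign, of `ι^* : Ω^•(M) → Ω^•(N)`, and
the sequence is the long exact sequence of that cone. The geometric input is that `ι^*` is a chain
map from `d_f` to `d_{f ∘ ι}` (`twistedD_pullback`). This holds because pullback commutes with `d`,
with `df ∧ ·` and with multiplication by `f`, while the coefficient `k` depends only on the degree.

The rest is linear algebra. A pair `(α, θ)` is a cocycle exactly when `α` is closed and `θ` is a
primitive of `ι^* α`; it is a coboundary exactly when `α = d_f β` and `θ = ι^* β - d_f η`. With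
these two descriptions (`relD_eq_zero_iff`, `mem_coboundaries_relD_succ_iff`) each exactness
statement is a choice of representatives. The identity `d_f ∘ d_f = 0` is never needed, because
`Cohomology` divides the cocycles by those coboundaries that are cocycles. -/

namespace FunctionCohomology

/-! ### Compatibility of pullback with the twisted differential -/

section Naturality

variable {E : Type*} [NormedAddCommGroup E] [NormedSpace ℝ E]
  {H : Type*} [TopologicalSpace H] {I : ModelWithCorners ℝ E H}
  {M : Type*} [TopologicalSpace M] [ChartedSpace H M] [IsManifold I ∞ M]
  {E' : Type*} [NormedAddCommGroup E'] [NormedSpace ℝ E']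
  {H' : Type*} [TopologicalSpace H'] {J : ModelWithCorners ℝ E' H'}
  {N : Type*} [TopologicalSpace N] [ChartedSpace H' N] [IsManifold J ∞ N]

/-- The exterior derivative commutes with pullbacks. -/
theorem roughD_roughPullback {k : ℕ} {φ : N → M} (hφ : ContMDiff J I ∞ φ) {α : RoughForm I M k}
    (hα : α ∈ Form I M k) :
    roughD (roughPullback (J := J) φ α) = roughPullback (J := J) φ (roughD α) := by
  have : IsManifold I 1 M := IsManifold.of_le (n := ∞) (by simp)
  have : IsManifold J 1 N := IsManifold.of_le (n := ∞) (by simp)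
  funext x
  have hy := mem_extChartAt_target (I := J) x
  have hyr := extChartAt_target_subset_range x hy
  have hback : φ ((extChartAt J x).symm (extChartAt J x x)) = φ x := by
    rw [extChartAt_to_inv]
  have hm : φ ((extChartAt J x).symm (extChartAt J x x)) ∈ (extChartAt I (φ x)).source := by
    rw [hback]
    exact mem_extChartAt_source (φ x)
  set g := extChartAt I (φ x) ∘ φ ∘ (extChartAt J x).symm with hg
  have hgs : ContDiffWithinAt ℝ ∞ g (range J) (extChartAt J x x) :=
    contDiffWithinAt_chartExpr hφ hy hm
  have hgx : g (extChartAt J x x) = extChartAt I (φ x) (φ x) :=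
    congrArg (extChartAt I (φ x)) hback
  have hgy : g (extChartAt J x x) ∈ (extChartAt I (φ x)).target :=
    (extChartAt I (φ x)).map_source hm
  -- The two sides agree near the point within `range J`, which is enough to compare exterior
  -- derivatives there.
  have e1 : extDerivWithin (inChart (roughPullback (J := J) φ α) x) (range J) (extChartAt J x x) =
      extDerivWithin (fun z => (inChart α (φ x) (g z)).compContinuousLinearMap
        (fderivWithin ℝ g (range J) z)) (range J) (extChartAt J x x) := by
    refine Filter.EventuallyEq.extDerivWithin_eq_of_mem ?_ hyr
    filter_upwards [eventually_mem_source hφ hy hm] with z hz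
    exact inChart_roughPullback hφ α hz.1 hz.2
  -- In the preferred charts at `x` and `φ x` this is the definition of `mfderiv`, whose
  -- differentiable branch applies.
  have e2 : fderivWithin ℝ g (range J) (extChartAt J x x) = mfderiv J I φ x := by
    exact (if_pos ((hφ x).mdifferentiableAt (by simp))).symm
  -- Naturality of `d` in the model space rests on symmetry of the second derivative of `g`: hence
  -- `2 ≤ ∞`, and a base point in the closure of the interior of `range J`.
  rw [extDerivWithin_pullback (r := ∞) (differentiableWithinAt_inChart hα hgy) hgs
    (by simpa using WithTop.coe_le_coe.2 (le_top : (2 : ℕ∞) ≤ ⊤)) J.uniqueDiffOn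
    (J.range_subset_closure_interior hyr) hyr (fun z _ => mem_range_self (f := I) _),
    e2, hgx] at e1
  -- The derivative of the preferred chart at its own base point is the identity, so the chart
  -- corrections in `roughD` disappear.
  simp only [roughD, roughPullback, mfderiv_extChartAt_self] at e1 ⊢
  exact e1

/-- The operation `dg ∧ ·` commutes with pullbacks. -/
theorem roughWedge_roughPullback {k : ℕ} {φ : N → M} (hφ : ContMDiff J I ∞ φ) {g : M → ℝ}
    (hg : ContMDiff I 𝓘(ℝ, ℝ) ∞ g) (α : RoughForm I M k) :
    roughWedge (g ∘ φ) (roughPullback (J := J) φ α) =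
      roughPullback (J := J) φ (roughWedge g α) := by
  funext x
  simp only [roughWedge, roughPullback]
  rw [mfderiv_comp x ((hg _).mdifferentiableAt (by simp)) ((hφ _).mdifferentiableAt (by simp))]
  exact (wedgeOne_comp (E := E') (F := E) (mfderiv I 𝓘(ℝ, ℝ) g (φ x)) (α (φ x))
    (mfderiv J I φ x)).symm

/-- Pullback along `φ` is a chain map from `d_f` to `d_{f ∘ φ}`. -/
theorem twistedD_pullback (f : C^∞⟮I, M; 𝓘(ℝ, ℝ), ℝ⟯) (φ : C^∞⟮J, N; I, M⟯) (k : ℕ)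
    (α : Form I M k) :
    twistedD (f.comp φ) k (pullback φ k α) = pullback φ (k + 1) (twistedD f k α) := by
  have hd : extD k (pullback φ k α) = pullback φ (k + 1) (extD k α) :=
    Subtype.ext (roughD_roughPullback φ.contMDiff α.2)
  have hw : dWedge (f.comp φ) k (pullback φ k α) = pullback φ (k + 1) (dWedge f k α) :=
    Subtype.ext (roughWedge_roughPullback φ.contMDiff f.contMDiff α.1)
  have hm (β : Form I M (k + 1)) :
      mulFun (f.comp φ) (k + 1) (pullback φ (k + 1) β) =
        pullback φ (k + 1) (mulFun f (k + 1) β) := rfl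
  simp only [twistedD, LinearMap.sub_apply, LinearMap.comp_apply, LinearMap.smul_apply, map_sub,
    map_smul, hd, hw, hm]

end Naturality

/-! ### Classes and induced maps in cohomology -/

section Cohomology

universe u v

variable {A : ℕ → Type u} [∀ k, AddCommGroup (A k)] [∀ k, Module ℝ (A k)]
  {B : ℕ → Type v} [∀ k, AddCommGroup (B k)] [∀ k, Module ℝ (B k)]
  {dA : ∀ k, A k →ₗ[ℝ] A (k + 1)} {dB : ∀ k, B k →ₗ[ℝ] B (k + 1)}

theorem exists_cohomologyClass_eq {k : ℕ} (c : Cohomology dA k) :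
    ∃ (a : A k) (ha : dA k a = 0), cohomologyClass dA a ha = c := by
  obtain ⟨⟨a, ha⟩, rfl⟩ := Submodule.Quotient.mk_surjective _ c
  exact ⟨a, ha, rfl⟩

theorem cohomologyClass_eq_iff {k : ℕ} {a b : A k} {ha : dA k a = 0} {hb : dA k b = 0} :
    cohomologyClass dA a ha = cohomologyClass dA b hb ↔ a - b ∈ coboundaries dA k :=
  Submodule.Quotient.eq _

theorem cohomologyClass_eq_zero_iff {k : ℕ} {a : A k} {ha : dA k a = 0} :
    cohomologyClass dA a ha = 0 ↔ a ∈ coboundaries dA k :=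
  Submodule.Quotient.mk_eq_zero _

/-- The map induced on cohomology by a linear map that preserves cocycles and coboundaries. -/
def cohomologyMap {k l : ℕ} (F : A k →ₗ[ℝ] B l) (hZ : ∀ a, dA k a = 0 → dB l (F a) = 0)
    (hB : ∀ a ∈ coboundaries dA k, F a ∈ coboundaries dB l) :
    Cohomology dA k →ₗ[ℝ] Cohomology dB l :=
  Submodule.mapQ _ _ (F.restrict hZ) fun a ha => hB a.1 ha

end Cohomology

/-! ### The three maps of the sequence -/

section Relative

variable {E : Type*} [NormedAddCommGroup E] [NormedSpace ℝ E]
  {H : Type*} [TopologicalSpace H] {I : ModelWithCorners ℝ E H}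
  {M : Type*} [TopologicalSpace M] [ChartedSpace H M] [IsManifold I ∞ M]
  {E' : Type*} [NormedAddCommGroup E'] [NormedSpace ℝ E']
  {H' : Type*} [TopologicalSpace H'] {J : ModelWithCorners ℝ E' H'}
  {N : Type*} [TopologicalSpace N] [ChartedSpace H' N] [IsManifold J ∞ N]
  (f : C^∞⟮I, M; 𝓘(ℝ, ℝ), ℝ⟯) (ι : C^∞⟮J, N; I, M⟯)

/-- Treats all degrees alike: the convention `Ω^{-1}(N) = 0` matches `B^0 = 0`, so the exactness
proofs need no separate case for coboundaries on `N`. -/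
theorem mem_coboundaries_twistedD_iff (g : C^∞⟮J, N; 𝓘(ℝ, ℝ), ℝ⟯) {k : ℕ} {β : Form J N k} :
    β ∈ coboundaries (twistedD g) k ↔ ∃ θ : PrevForm J N k, prevTwistedD g k θ = β := by
  cases k with
  | zero => exact ⟨fun h => ⟨0, ((Submodule.mem_bot ℝ).1 h).symm⟩,
      fun ⟨_, h⟩ => (Submodule.mem_bot ℝ).2 h.symm⟩
  | succ k => exact LinearMap.mem_range

theorem relD_eq_zero_iff {k : ℕ} {α : Form I M k} {θ : PrevForm J N k} :
    relD f ι k (α, θ) = 0 ↔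
      twistedD f k α = 0 ∧ pullback ι k α = prevTwistedD (f.comp ι) k θ := by
  rw [← sub_eq_zero (a := pullback ι k α)]
  exact Prod.mk_eq_zero

theorem mem_coboundaries_relD_succ_iff {k : ℕ} {α : Form I M (k + 1)} {θ : Form J N k} :
    ((α, θ) : RelForm I M J N (k + 1)) ∈ coboundaries (relD f ι) (k + 1) ↔
      ∃ (β : Form I M k) (η : PrevForm J N k), twistedD f k β = α ∧
        pullback ι k β - prevTwistedD (f.comp ι) k η = θ :=
  ⟨fun ⟨p, hp⟩ => ⟨p.1, p.2, congrArg Prod.fst hp, congrArg Prod.snd hp⟩,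
    fun ⟨β, η, h₁, h₂⟩ => ⟨(β, η), Prod.ext h₁ h₂⟩⟩

/-- The map `H^k_f(M, N) → H^k_f(M)`, `[(α, θ)] ↦ [α]`. -/
noncomputable def relToAbs (k : ℕ) : HRel f ι k →ₗ[ℝ] HFun f k :=
  cohomologyMap (LinearMap.fst ℝ (Form I M k) (PrevForm J N k))
    (fun p hp => ((relD_eq_zero_iff f ι (α := p.1) (θ := p.2)).1 hp).1)
    (fun p hp => by
      cases k with
      | zero => exact (Submodule.mem_bot ℝ).2 (congrArg Prod.fst ((Submodule.mem_bot ℝ).1 hp))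
      | succ k =>
        obtain ⟨β, η, h, -⟩ := (mem_coboundaries_relD_succ_iff f ι (α := p.1) (θ := p.2)).1 hp
        exact ⟨β, h⟩)

/-- The map `ι^* : H^k_f(M) → H^k_f(N)`. -/
noncomputable def cohomologyPullback (k : ℕ) : HFun f k →ₗ[ℝ] HFun (f.comp ι) k :=
  cohomologyMap (pullback ι k)
    (fun α hα => by rw [twistedD_pullback, hα, map_zero])
    (fun α hα => by
      cases k with
      | zero => exact (Submodule.mem_bot ℝ).2 (by rw [(Submodule.mem_bot ℝ).1 hα, map_zero])
      | succ k =>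
        obtain ⟨β, rfl⟩ := hα
        exact ⟨pullback ι k β, twistedD_pullback f ι k β⟩)

theorem relD_zero_prod {k : ℕ} {θ : Form J N k} (hθ : twistedD (f.comp ι) k θ = 0) :
    relD f ι (k + 1) (0, θ) = 0 :=
  (relD_eq_zero_iff f ι (k := k + 1)).2 ⟨map_zero _, (map_zero _).trans hθ.symm⟩

/-- The connecting map `H^k_f(N) → H^{k+1}_f(M, N)`, `[θ] ↦ [(0, θ)]`. -/
noncomputable def connecting (k : ℕ) : HFun (f.comp ι) k →ₗ[ℝ] HRel f ι (k + 1) :=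
  -- The inclusion `θ ↦ (0, θ)` anticommutes with the differentials, since `(0, θ) ↦ (0, -d_f θ)`.
  -- It still preserves cocycles and coboundaries, which is all that `cohomologyMap` asks for.
  cohomologyMap (B := RelForm I M J N) (l := k + 1)
    (LinearMap.inr ℝ (Form I M (k + 1)) (Form J N k))
    (fun _ hθ => relD_zero_prod f ι hθ)
    (fun θ hθ => by
      obtain ⟨η, hη⟩ := (mem_coboundaries_twistedD_iff (f.comp ι)).1 hθ
      exact (mem_coboundaries_relD_succ_iff f ι).2
        -- The minus sign in the cone differential forces `-η`: the pair `(0, -η)` is sent to `(0,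
        -- d_f η)`.
        ⟨0, -η, map_zero _, by rw [map_zero, map_neg, sub_neg_eq_add, zero_add, hη]; rfl⟩)

theorem relToAbs_cohomologyClass {k : ℕ} {α : Form I M k} {θ : PrevForm J N k}
    (h : relD f ι k (α, θ) = 0) :
    relToAbs f ι k (cohomologyClass (relD f ι) (α, θ) h) =
      cohomologyClass (twistedD f) α ((relD_eq_zero_iff f ι).1 h).1 :=
  rfl

theorem cohomologyPullback_cohomologyClass {k : ℕ} {α : Form I M k} (h : twistedD f k α = 0) :
    cohomologyPullback f ι k (cohomologyClass (twistedD f) α h) =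
      cohomologyClass (twistedD (f.comp ι)) (pullback ι k α)
        (by rw [twistedD_pullback, h, map_zero]) :=
  rfl

theorem connecting_cohomologyClass {k : ℕ} {θ : Form J N k} (h : twistedD (f.comp ι) k θ = 0) :
    connecting f ι k (cohomologyClass (twistedD (f.comp ι)) θ h) =
      cohomologyClass (relD f ι) (k := k + 1) (0, θ) (relD_zero_prod f ι h) :=
  rfl

/-! ### Exactness -/

theorem relToAbs_zero_injective : Function.Injective (relToAbs f ι 0) := by
  rw [injective_iff_map_eq_zero]
  intro c hc
  obtain ⟨⟨α, θ⟩, h, rfl⟩ := exists_cohomologyClass_eq c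
  rw [relToAbs_cohomologyClass, cohomologyClass_eq_zero_iff] at hc
  have hα : α = 0 := (Submodule.mem_bot ℝ).1 hc
  -- In degree zero the second component lives in `PUnit`, so it vanishes by `rfl`.
  exact cohomologyClass_eq_zero_iff.2 ((Submodule.mem_bot ℝ).2 (Prod.ext hα rfl))

/-- A primitive `θ` of `ι^* α` is precisely what completes a closed `α` to a relative cocycle `(α,
θ)`. -/
theorem exact_relToAbs_cohomologyPullback (k : ℕ) :
    Function.Exact (relToAbs f ι k) (cohomologyPullback f ι k) := by
  intro c
  obtain ⟨α, hα, rfl⟩ := exists_cohomologyClass_eq c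
  rw [cohomologyPullback_cohomologyClass, cohomologyClass_eq_zero_iff,
    mem_coboundaries_twistedD_iff]
  constructor
  · rintro ⟨θ, hθ⟩
    exact ⟨cohomologyClass (relD f ι) (α, θ) ((relD_eq_zero_iff f ι).2 ⟨hα, hθ.symm⟩), rfl⟩
  · rintro ⟨c, hc⟩
    obtain ⟨⟨β, θ⟩, h, rfl⟩ := exists_cohomologyClass_eq c
    obtain ⟨-, h⟩ := (relD_eq_zero_iff f ι).1 h
    rw [relToAbs_cohomologyClass, cohomologyClass_eq_iff] at hc
    -- Pullback preserves coboundaries; degree zero is separate because there the coboundaries on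
    -- `M` are `⊥` rather than a range.
    have key : pullback ι k (β - α) ∈ coboundaries (twistedD (f.comp ι)) k := by
      cases k with
      | zero =>
        exact (Submodule.mem_bot ℝ).2
          ((congrArg _ ((Submodule.mem_bot ℝ).1 hc)).trans (map_zero _))
      | succ k =>
        obtain ⟨γ, hγ⟩ := hc
        exact ⟨pullback ι k γ, (twistedD_pullback f ι k γ).trans (congrArg _ hγ)⟩
    obtain ⟨η, hη⟩ := (mem_coboundaries_twistedD_iff _).1 key
    -- Here `d_f θ = ι^* β` and `d_f η = ι^* (β - α)`, so the difference is a primitive of `ι^* α`.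
    exact ⟨θ - η, by rw [map_sub, hη, ← h, map_sub, sub_sub_cancel]⟩

/-- The pair `(0, θ)` bounds `(β, η)` exactly when `d_f β = 0` and `ι^* β - θ = d_f η`, that is,
when `[θ] = ι^* [β]`. -/
theorem exact_cohomologyPullback_connecting (k : ℕ) :
    Function.Exact (cohomologyPullback f ι k) (connecting f ι k) := by
  intro c
  obtain ⟨θ, hθ, rfl⟩ := exists_cohomologyClass_eq c
  rw [connecting_cohomologyClass, cohomologyClass_eq_zero_iff]
  refine (mem_coboundaries_relD_succ_iff f ι).trans ⟨?_, ?_⟩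
  · rintro ⟨β, η, hβ, h⟩
    refine ⟨cohomologyClass (twistedD f) β hβ, ?_⟩
    rw [cohomologyPullback_cohomologyClass, cohomologyClass_eq_iff,
      mem_coboundaries_twistedD_iff]
    exact ⟨η, by rw [← h, sub_sub_cancel]⟩
  · rintro ⟨c, hc⟩
    obtain ⟨β, hβ, rfl⟩ := exists_cohomologyClass_eq c
    rw [cohomologyPullback_cohomologyClass, cohomologyClass_eq_iff,
      mem_coboundaries_twistedD_iff] at hc
    obtain ⟨η, hη⟩ := hc
    exact ⟨β, η, hβ, by rw [hη, sub_sub_cancel]⟩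

/-- If `α = d_f β`, subtracting the coboundary of `(β, 0)` from `(α, θ)` leaves `(0, θ - ι^* β)`,
which comes from `N`. -/
theorem exact_connecting_relToAbs (k : ℕ) :
    Function.Exact (connecting f ι k) (relToAbs f ι (k + 1)) := by
  intro c
  obtain ⟨⟨α, θ⟩, h, rfl⟩ := exists_cohomologyClass_eq c
  obtain ⟨-, hθ⟩ := (relD_eq_zero_iff f ι (k := k + 1)).1 h
  rw [relToAbs_cohomologyClass, cohomologyClass_eq_zero_iff]
  change Form J N k at θ
  constructor
  · rintro ⟨β, hβ⟩
    -- By the chain map property `d_f (ι^* β) = ι^* α`, and this equals `d_f θ` by the cocycle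
    -- condition.
    have hη : twistedD (f.comp ι) k (θ - pullback ι k β) = 0 := by
      rw [map_sub, twistedD_pullback, hβ]
      exact sub_eq_zero.2 hθ.symm
    refine ⟨cohomologyClass _ _ hη, ?_⟩
    rw [connecting_cohomologyClass, cohomologyClass_eq_iff]
    -- The difference of the representatives is `(-α, -ι^* β)`, the coboundary of `(-β, 0)`.
    refine (mem_coboundaries_relD_succ_iff f ι (α := 0 - α)
      (θ := (θ - pullback ι k β) - θ)).2 ⟨-β, 0, ?_, ?_⟩
    · rw [map_neg, hβ, zero_sub]
    · rw [map_zero, sub_zero, map_neg]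
      exact (sub_sub_cancel_left θ (pullback ι k β)).symm
  · rintro ⟨c, hc⟩
    obtain ⟨η, hη, rfl⟩ := exists_cohomologyClass_eq c
    rw [connecting_cohomologyClass, cohomologyClass_eq_iff] at hc
    obtain ⟨β, ζ, hβ, -⟩ := (mem_coboundaries_relD_succ_iff f ι (α := 0 - α) (θ := η - θ)).1 hc
    exact ⟨-β, by rw [map_neg, hβ, zero_sub, neg_neg]⟩

end Relative

end FunctionCohomology


theorem mainTheorem6
    {E : Type*} [NormedAddCommGroup E] [NormedSpace ℝ E] [FiniteDimensional ℝ E]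
    {H : Type*} [TopologicalSpace H] (I : ModelWithCorners ℝ E H)
    {M : Type*} [TopologicalSpace M] [ChartedSpace H M] [IsManifold I ∞ M]
    {E' : Type*} [NormedAddCommGroup E'] [NormedSpace ℝ E'] [FiniteDimensional ℝ E']
    {H' : Type*} [TopologicalSpace H'] (J : ModelWithCorners ℝ E' H')
    {N : Type*} [TopologicalSpace N] [ChartedSpace H' N] [IsManifold J ∞ N]
    (f : C^∞⟮I, M; 𝓘(ℝ, ℝ), ℝ⟯)
    (ι : C^∞⟮J, N; I, M⟯) (hinj : Function.Injective ι)
    (himm : ∀ y : N, Function.Injective (mfderiv J I ι y))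
    (hS : ¬ range ι ⊆ {x | f x = 0}) :
    ∃ (i : ∀ k, HRel f ι k →ₗ[ℝ] HFun f k) (r : ∀ k, HFun f k →ₗ[ℝ] HFun (f.comp ι) k)
      (δ : ∀ k, HFun (f.comp ι) k →ₗ[ℝ] HRel f ι (k + 1)),
      (∀ k (α : Form I M k) (θ : PrevForm J N k) (h : relD f ι k (α, θ) = 0),
        ∃ h' : twistedD f k α = 0,
          i k (cohomologyClass (relD f ι) (α, θ) h) = cohomologyClass (twistedD f) α h') ∧
      (∀ k (α : Form I M k) (h : twistedD f k α = 0),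
        ∃ h' : twistedD (f.comp ι) k (pullback ι k α) = 0,
          r k (cohomologyClass (twistedD f) α h) =
            cohomologyClass (twistedD (f.comp ι)) (pullback ι k α) h') ∧
      (∀ k (θ : Form J N k) (h : twistedD (f.comp ι) k θ = 0),
        ∃ h' : relD f ι (k + 1) (0, θ) = 0,
          δ k (cohomologyClass (twistedD (f.comp ι)) θ h) =
            cohomologyClass (relD f ι) (k := k + 1) (0, θ) h') ∧
      Function.Injective (i 0) ∧
      ∀ k, Function.Exact (i k) (r k) ∧ Function.Exact (r k) (δ k) ∧
        Function.Exact (δ k) (i (k + 1)) := by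
  exact ⟨relToAbs f ι, cohomologyPullback f ι, connecting f ι,
    fun _ _ _ h => ⟨((relD_eq_zero_iff f ι).1 h).1, rfl⟩,
    fun k α h => ⟨by rw [twistedD_pullback, h, map_zero], rfl⟩,
    fun _ _ h => ⟨relD_zero_prod f ι h, rfl⟩,
    relToAbs_zero_injective f ι,
    fun k => ⟨exact_relToAbs_cohomologyPullback f ι k, exact_cohomologyPullback_connecting f ι k,
      exact_connecting_relToAbs f ι k⟩⟩
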